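/- For $u\in\ell^2(\mathbb{Z})$ (complex valued) let $F(u)\in L^2((-\pi,\pi))$, $F(u)(x)=(2\pi)^{-1/2}\sum_{n\in\mathbb{Z}}u(n)e^{-inx}$ (convergence in $L^2$), be its Fourier transform, with inverse $F^{-1}(f)(n)=(2\pi)^{-1/2}\int_{-\pi}^{\pi}f(x)e^{inx}\,dx$. For a measurable set $A\subseteq\mathbb{R}$ let $A^*$ be the open interval centered at the origin with the same Lebesgue measure as $A$, and for a measurable function $f$ on $(-\pi,\pi)$, extended by zero to $\mathbb{R}$, let $f^*(x)=\int_0^\infty\chi_{\{|f|>t\}^*}(x)\,dt$ be its symmetric decreasing rearrangement. The Fourier rearrangement of $u$ is $u^\#:=F^{-1}(F(u)^*)$. For every real $p>2$ there is a constant $c(p)$, depending only on $p$, such that for all $u\in\ell^2(\mathbb{Z})$ both of the following series converge and $$\sum_{n\in\mathbb{Z}}|u(n)|^p\le c(p)\sum_{n\in\mathbb{Z}}|u^\#(n)|^p .$$ -/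

import Mathlib

open MeasureTheory

noncomputable section

namespace FourierRearrangement

/-- The space `ℓ²(ℤ)` of square summable functions `ℤ → ℂ`. -/
abbrev SqSummable : Type := lp (fun _ : ℤ => ℂ) 2

/-- Lebesgue measure on the interval `(-π, π)`. -/
abbrev circleVol : Measure ℝ := volume.restrict (Set.Ioo (-Real.pi) Real.pi)

/-- The function `x ↦ (2π)^(-1/2) exp(-i n x)`. -/
def expFun (n : ℤ) (x : ℝ) : ℂ :=
  ((Real.sqrt (2 * Real.pi))⁻¹ : ℝ) * Complex.exp (-(Complex.I * n * x))

theorem continuous_expFun (n : ℤ) : Continuous (expFun n) := by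
  unfold expFun
  fun_prop

theorem norm_expFun (n : ℤ) (x : ℝ) : ‖expFun n x‖ = (Real.sqrt (2 * Real.pi))⁻¹ := by
  have h : -(Complex.I * n * x) = ((-(n * x) : ℝ) : ℂ) * Complex.I := by push_cast; ring
  rw [expFun, h, norm_mul, Complex.norm_exp_ofReal_mul_I, mul_one, Complex.norm_real,
    Real.norm_of_nonneg (by positivity)]

theorem memLp_expFun (n : ℤ) : MemLp (expFun n) 2 circleVol :=
  MemLp.of_bound (continuous_expFun n).aestronglyMeasurable (Real.sqrt (2 * Real.pi))⁻¹
    (Filter.Eventually.of_forall fun x => (norm_expFun n x).le)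

/-- `x ↦ (2π)^(-1/2) exp(-i n x)` as an element of `L²((-π, π))`. -/
def expLp (n : ℤ) : Lp ℂ 2 circleVol := (memLp_expFun n).toLp (expFun n)

theorem orthonormal_expLp : Orthonormal ℂ expLp := by
  rw [orthonormal_iff_ite]
  intro m n
  have h1 : inner ℂ (expLp m) (expLp n) =
      ∫ x in (-Real.pi)..Real.pi,
        ((2 * Real.pi)⁻¹ : ℂ) * Complex.exp (((m - n : ℂ) * Complex.I) * x) := by
    rw [intervalIntegral.integral_of_le (by linarith [Real.pi_pos]),
      integral_Ioc_eq_integral_Ioo, L2.inner_def]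
    refine integral_congr_ae ?_
    filter_upwards [(memLp_expFun m).coeFn_toLp, (memLp_expFun n).coeFn_toLp] with x hm hn
    rw [expLp, expLp, hm, hn, expFun, expFun, RCLike.inner_apply, map_mul, Complex.conj_ofReal,
      ← Complex.exp_conj]
    have h2 : (((Real.sqrt (2 * Real.pi))⁻¹ : ℝ) : ℂ) * ((Real.sqrt (2 * Real.pi))⁻¹ : ℝ) =
        (2 * Real.pi)⁻¹ := by
      rw [← Complex.ofReal_mul, ← mul_inv, Real.mul_self_sqrt (by positivity)]
    rw [mul_mul_mul_comm, h2, ← Complex.exp_add]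
    congr 1
    · push_cast
      rfl
    congr 1
    simp only [map_neg, map_mul, Complex.conj_I, Complex.conj_ofReal, map_intCast]
    ring
  rw [h1, intervalIntegral.integral_const_mul]
  have hpi : (Real.pi : ℂ) ≠ 0 := by exact_mod_cast Real.pi_ne_zero
  split_ifs with hmn
  · subst hmn
    simp
    field_simp
    ring
  · have hc : ((m - n : ℂ) * Complex.I) ≠ 0 :=
      mul_ne_zero (sub_ne_zero.2 (by exact_mod_cast hmn)) Complex.I_ne_zero
    rw [integral_exp_mul_complex hc]
    have h3 : Complex.exp ((m - n : ℂ) * Complex.I * (Real.pi : ℝ)) =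
        Complex.exp ((m - n : ℂ) * Complex.I * ((-Real.pi : ℝ) : ℂ)) := by
      rw [Complex.exp_eq_exp_iff_exists_int]
      exact ⟨m - n, by push_cast; ring⟩
    rw [h3]
    simp

/-- The Fourier transform `F(u)(x) = (2π)^(-1/2) ∑ₙ u(n) exp(-i n x)` of `u ∈ ℓ²(ℤ)`; the series is
the sum of a summable family in `L²((-π, π))`, see `summable_fourierTransform`. -/
def fourierTransform (u : SqSummable) : Lp ℂ 2 circleVol := ∑' n : ℤ, u n • expLp n

theorem summable_fourierTransform (u : SqSummable) : Summable fun n : ℤ => u n • expLp n := by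
  simpa using orthonormal_expLp.orthogonalFamily.summable_of_lp u

/-- The inverse transform `F⁻¹(f)(n) = (2π)^(-1/2) ∫_{-π}^{π} f(x) exp(i n x) dx`. -/
def fourierInv (f : ℝ → ℂ) (n : ℤ) : ℂ :=
  ((Real.sqrt (2 * Real.pi))⁻¹ : ℝ) *
    ∫ x in Set.Ioo (-Real.pi) Real.pi, f x * Complex.exp (Complex.I * n * x)

/-- The symmetric rearrangement `A^*` of a set `A ⊆ ℝ`: the open ball centred at the origin with
the same Lebesgue measure as `A` (all of `ℝ` if that measure is infinite). -/
def setRearr (A : Set ℝ) : Set ℝ := Metric.eball 0 (volume A / 2)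

theorem volume_setRearr (A : Set ℝ) : volume (setRearr A) = volume A := by
  rw [setRearr, Real.volume_eball, ENNReal.mul_div_cancel (by simp) (by simp)]

/-- The symmetric decreasing rearrangement `f^*(x) = ∫₀^∞ χ_{{|f| > t}^*}(x) dt` of `f : ℝ → ℂ`,
with values in `[0, ∞]`. -/
def symmDecrRearr (f : ℝ → ℂ) (x : ℝ) : ENNReal :=
  ∫⁻ t in Set.Ioi (0 : ℝ), (setRearr {y | t < ‖f y‖}).indicator (fun _ => 1) x

/-- The Fourier rearrangement `u^# = F⁻¹(F(u)^*)` of `u ∈ ℓ²(ℤ)`. Here `F(u)` is extended by zero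
from `(-π, π)` to `ℝ`; its rearrangement is finite except possibly at the origin. -/
def fourierRearr (u : SqSummable) : ℤ → ℂ :=
  fourierInv fun x =>
    ((symmDecrRearr ((Set.Ioo (-Real.pi) Real.pi).indicator (fourierTransform u)) x).toReal : ℂ)

end FourierRearrangement

end

noncomputable section

namespace FourierRearrangement

/-! Let `f` be `F(u)` extended by zero and `A k` the integral of its rearrangement over `(-2⁻ᵏ,
2⁻ᵏ)` (`dyadicMass`). Both sides of the inequality are compared with `∑ 2 ^ k * A k ^ p`.

For the right side, the rearrangement is nonnegative, so testing it against the Fejér kernel of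
order `2 ^ k` bounds `A k` by a constant times the average of `|u^#(n)|` over `|n| < 2 ^ k`
(`setIntegral_ball_le`). A dyadic Hardy inequality (`exists_sum_dyadic_average_rpow_le`) then bounds
the sum by `∑ |u^#(n)| ^ p`.

For the left side, cut `f` at height `2 ^ k * A k`, which is exceeded on a set of measure at most `2
* 2⁻ᵏ`. The upper part has `L¹` norm, hence Fourier coefficients, at most `A k`; the lower part has
energy at most `8 * ∑_{j ≤ k} 2 ^ j * A j ^ 2` (`integral_sq_below_level_le`), which Bessel passes
to its coefficients. If `k` is the first index with `2 * A k < |u(n)|`, then `|u(n)|` is comparable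
to `A k` and at least half of it comes from the lower part. Summing over `n` level by level leaves
`∑ A k ^ (p - 2) * ∑_{j ≤ k} 2 ^ j * A j ^ 2`, and `p > 2` makes this at most a constant times `∑ 2
^ k * A k ^ p`. -/

/-! ### Discrete Hardy inequalities and interpolation. -/

/-- A sequence with `e (k+1) ≤ r * e k + t k` and `r < 1` has its `ℓ^q` norm controlled by `t`. -/
theorem exists_sum_rpow_le_of_contraction {q r : ℝ} (hq : 1 ≤ q) (hr0 : 0 ≤ r) (hr1 : r < 1) :
    ∃ C : ℝ, 0 ≤ C ∧ ∀ e t : ℕ → ℝ, (∀ k, 0 ≤ e k) → (∀ k, 0 ≤ t k) →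
      (∀ k, e (k + 1) ≤ r * e k + t k) →
      ∀ K, ∑ k ∈ Finset.range K, e k ^ q ≤
        C * (e 0 ^ q + ∑ k ∈ Finset.range K, t k ^ q) := by
  have hr : 0 < 1 - r := by linarith
  -- The second entry comes from convexity applied to `r * e + (1 - r) * ((1 - r)⁻¹ * t)`; the first
  -- lets `D` absorb the initial term.
  set D : ℝ := max 1 ((1 - r) * ((1 - r)⁻¹) ^ q) with hD
  refine ⟨(1 - r)⁻¹ * D, by positivity, fun e t he ht h K => ?_⟩
  have step : ∀ k, e (k + 1) ^ q ≤ r * e k ^ q + D * t k ^ q := by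
    intro k
    have hc := (convexOn_rpow hq).2 (x := e k) (he k) (y := (1 - r)⁻¹ * t k)
      (by have := ht k; simp only [Set.mem_Ici]; positivity) hr0 hr.le (by ring)
    simp only [smul_eq_mul] at hc
    rw [mul_inv_cancel_left₀ hr.ne', Real.mul_rpow (by positivity) (ht k), ← mul_assoc (1 - r)]
      at hc
    have h0 := Real.rpow_nonneg (ht k) q
    calc e (k + 1) ^ q ≤ (r * e k + t k) ^ q :=
          Real.rpow_le_rpow (he _) (h k) (by linarith)
      _ ≤ _ := hc
      _ ≤ _ := by gcongr; exact le_max_right _ _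
  have h1 : ∑ k ∈ Finset.range K, e k ^ q ≤ ∑ k ∈ Finset.range (K + 1), e k ^ q := by
    rw [Finset.sum_range_succ]
    have := Real.rpow_nonneg (he K) q
    linarith
  rw [Finset.sum_range_succ'] at h1
  have h2 : ∑ k ∈ Finset.range K, e (k + 1) ^ q ≤
      r * ∑ k ∈ Finset.range K, e k ^ q + D * ∑ k ∈ Finset.range K, t k ^ q := by
    rw [Finset.mul_sum, Finset.mul_sum, ← Finset.sum_add_distrib]
    exact Finset.sum_le_sum fun k _ => step k
  have h3 : e 0 ^ q ≤ D * e 0 ^ q :=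
    le_mul_of_one_le_left (Real.rpow_nonneg (he 0) q) (le_max_left _ _)
  rw [mul_assoc, ← div_eq_inv_mul, le_div_iff₀ hr]
  linarith

/-- A dyadic form of Hardy's inequality on `ℤ`. -/
theorem exists_sum_dyadic_average_rpow_le {p : ℝ} (hp : 1 < p) :
    ∃ C : ℝ, 0 ≤ C ∧ ∀ a : ℤ → ℝ, (∀ n, 0 ≤ a n) → Summable (fun n => a n ^ p) →
      ∀ K, ∑ k ∈ Finset.range K,
          2 ^ k * ((2 ^ k)⁻¹ * ∑ n ∈ Finset.Ioo (-2 ^ k : ℤ) (2 ^ k), a n) ^ p ≤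
        C * ∑' n, a n ^ p := by
  have hp0 : 0 < p := by linarith
  -- Chosen so that `(r ^ k * S k) ^ p = 2 ^ k * (2⁻ᵏ * S k) ^ p`; `p > 1` is what gives `r < 1`.
  set r : ℝ := 2 ^ (p⁻¹ - 1) with hr
  have hr1 : r < 1 := Real.rpow_lt_one_of_one_lt_of_neg one_lt_two
    (by linarith [inv_lt_one_of_one_lt₀ hp])
  have hrpos : 0 < r := by positivity
  have hrp : r ^ p = 2 * 2⁻¹ ^ p := by
    rw [hr, ← Real.rpow_mul (by norm_num), sub_mul, inv_mul_cancel₀ hp0.ne',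
      Real.rpow_sub (by norm_num), Real.rpow_one, one_mul, Real.inv_rpow (by norm_num)]
    rfl
  obtain ⟨C, hC, H⟩ := exists_sum_rpow_le_of_contraction hp.le hrpos.le hr1
  refine ⟨C * (1 + 2 ^ (p - 1)), by positivity, fun a ha hs K => ?_⟩
  set I : ℕ → Finset ℤ := fun k => Finset.Ioo (-2 ^ k : ℤ) (2 ^ k) with hI
  have hmono : ∀ k, I k ⊆ I (k + 1) := by
    intro k n hn
    simp only [hI, Finset.mem_Ioo, pow_succ] at hn ⊢
    have : (0 : ℤ) < 2 ^ k := by positivity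
    constructor <;> linarith [hn.1, hn.2]
  set S : ℕ → ℝ := fun k => ∑ n ∈ I k, a n with hS
  set T : ℕ → ℝ := fun k => ∑ n ∈ I (k + 1) \ I k, a n with hT
  have hS0 : ∀ k, 0 ≤ S k := fun k => Finset.sum_nonneg fun n _ => ha n
  have hT0 : ∀ k, 0 ≤ T k := fun k => Finset.sum_nonneg fun n _ => ha n
  have hST : ∀ k, S (k + 1) = S k + T k := fun k => by
    linarith [Finset.sum_sdiff (f := a) (hmono k)]
  have hscale : ∀ (k : ℕ) (x : ℝ), 0 ≤ x →
      (r ^ k * x) ^ p = 2 ^ k * ((2 ^ k)⁻¹ * x) ^ p := by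
    intro k x hx
    rw [Real.mul_rpow (by positivity) hx, Real.mul_rpow (by positivity) hx, ← mul_assoc]
    congr 1
    rw [← Real.rpow_natCast r k, ← Real.rpow_mul hrpos.le, mul_comm (k : ℝ) p,
      Real.rpow_mul hrpos.le, hrp, Real.rpow_natCast, mul_pow, ← inv_pow,
      ← Real.rpow_natCast (2⁻¹ ^ p), ← Real.rpow_mul (by positivity), mul_comm p,
      Real.rpow_mul (by positivity), Real.rpow_natCast]
  have key := H (fun k => r ^ k * S k) (fun k => r ^ (k + 1) * T k)
    (fun k => mul_nonneg (by positivity) (hS0 k)) (fun k => mul_nonneg (by positivity) (hT0 k))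
    (fun k => by rw [hST]; exact le_of_eq (by ring)) K
  simp only [hscale _ _ (hS0 _), hscale _ _ (hT0 _)] at key
  refine key.trans ?_
  rw [mul_assoc]
  gcongr
  rw [add_mul, one_mul]
  have hap : ∀ n, 0 ≤ a n ^ p := fun n => Real.rpow_nonneg (ha n) p
  gcongr
  · have : I 0 = {0} := by rw [hI]; rfl
    simp only [hS, this, Finset.sum_singleton, pow_zero, inv_one, one_mul]
    exact hs.le_tsum 0 fun n _ => hap n
  -- Hölder on a block of at most `2 * 2 ^ (k + 1)` points: the powers of `2 ^ (k + 1)` cancel, and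
  -- the block sums then telescope.
  · have hblock : ∀ k, 2 ^ (k + 1) * ((2 ^ (k + 1))⁻¹ * T k) ^ p ≤
        2 ^ (p - 1) * (∑ n ∈ I (k + 1), a n ^ p - ∑ n ∈ I k, a n ^ p) := by
      intro k
      have hcard : ((I (k + 1) \ I k).card : ℝ) ≤ 2 * 2 ^ (k + 1) := by
        have h1 : (I (k + 1) \ I k).card ≤ (I (k + 1)).card :=
          Finset.card_le_card Finset.sdiff_subset
        have h2 : (I (k + 1)).card ≤ 2 * 2 ^ (k + 1) := by
          simp only [hI, Int.card_Ioo]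
          have : ((2 * 2 ^ (k + 1) : ℕ) : ℤ) = 2 * 2 ^ (k + 1) := by push_cast; ring
          omega
        exact_mod_cast h1.trans h2
      have hpw := Real.rpow_sum_le_const_mul_sum_rpow_of_nonneg (I (k + 1) \ I k) hp.le
        (f := a) (fun n _ => ha n)
      have hsd : ∑ n ∈ I (k + 1), a n ^ p - ∑ n ∈ I k, a n ^ p =
          ∑ n ∈ I (k + 1) \ I k, a n ^ p := by
        rw [← Finset.sum_sdiff (hmono k)]; ring
      rw [hsd]
      set N : ℝ := 2 ^ (k + 1) with hN
      have hNpos : 0 < N := by positivity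
      have hsum0 : 0 ≤ ∑ n ∈ I (k + 1) \ I k, a n ^ p := Finset.sum_nonneg fun n _ => hap n
      have hN1 : N * N⁻¹ ^ p * N ^ (p - 1) = 1 := by
        rw [Real.inv_rpow hNpos.le, Real.rpow_sub hNpos, Real.rpow_one]
        have := Real.rpow_pos_of_pos hNpos p
        field_simp
      calc N * (N⁻¹ * T k) ^ p = N * N⁻¹ ^ p * T k ^ p := by
            rw [Real.mul_rpow (by positivity) (hT0 k)]; ring
        _ ≤ N * N⁻¹ ^ p * ((2 * N) ^ (p - 1) * ∑ n ∈ I (k + 1) \ I k, a n ^ p) := by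
            gcongr
            refine hpw.trans ?_
            gcongr
        _ = (N * N⁻¹ ^ p * N ^ (p - 1)) * (2 ^ (p - 1) * ∑ n ∈ I (k + 1) \ I k, a n ^ p) := by
            rw [Real.mul_rpow (by norm_num) hNpos.le]; ring
        _ = _ := by rw [hN1, one_mul]
    refine (Finset.sum_le_sum fun k _ => hblock k).trans ?_
    rw [← Finset.mul_sum, Finset.sum_range_sub (fun k => ∑ n ∈ I k, a n ^ p)]
    gcongr
    have h1 := hs.sum_le_tsum (I K) fun n _ => hap n
    have h2 : 0 ≤ ∑ n ∈ I 0, a n ^ p := Finset.sum_nonneg fun n _ => hap n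
    linarith

/-- A form of Young's inequality: compare `y` with `x ^ 2` and replace the smaller by the larger. -/
theorem rpow_sub_two_mul_le {p x y : ℝ} (hp : 2 < p) (hx : 0 ≤ x) (hy : 0 ≤ y) :
    x ^ (p - 2) * y ≤ x ^ p + y ^ (p / 2) := by
  have h1 := Real.rpow_nonneg hx p
  have h2 := Real.rpow_nonneg hy (p / 2)
  have hpow : ∀ z : ℝ, 0 ≤ z → z ^ (p - 2) * z ^ 2 = z ^ p := fun z hz => by
    rw [← Real.rpow_natCast z 2, ← Real.rpow_add_of_nonneg hz (by linarith) (by norm_num)]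
    norm_num
  rcases le_total y (x ^ 2) with h | h
  · calc x ^ (p - 2) * y ≤ x ^ (p - 2) * x ^ 2 := by gcongr
      _ = x ^ p := hpow x hx
      _ ≤ _ := by linarith
  · have hs : y ^ (p / 2) = Real.sqrt y ^ p := by
      rw [Real.sqrt_eq_rpow, ← Real.rpow_mul hy]; congr 1; ring
    calc x ^ (p - 2) * y ≤ Real.sqrt y ^ (p - 2) * Real.sqrt y ^ 2 := by
          rw [Real.sq_sqrt hy]
          gcongr
          exact Real.le_sqrt_of_sq_le h
      _ = y ^ (p / 2) := by rw [hpow _ (Real.sqrt_nonneg y), hs]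
      _ ≤ _ := by linarith

/-- The weighted sums appearing in the interpolation between `ℓ^∞` and `ℓ²`. -/
theorem exists_sum_rpow_mul_sum_sq_le {p : ℝ} (hp : 2 < p) :
    ∃ C : ℝ, 0 ≤ C ∧ ∀ (A : ℕ → ℝ) (H : ℝ), (∀ k, 0 ≤ A k) →
      (∀ K, ∑ k ∈ Finset.range K, 2 ^ k * A k ^ p ≤ H) →
      ∀ K, ∑ k ∈ Finset.range K,
        A k ^ (p - 2) * ∑ j ∈ Finset.range (k + 1), 2 ^ j * A j ^ 2 ≤ C * H := by
  have hp0 : 0 < p := by linarith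
  set s : ℝ := 2 ^ p⁻¹ with hs
  have hspos : 0 < s := by positivity
  have hs1 : s ^ p = 2 := by
    rw [hs, ← Real.rpow_mul (by norm_num), inv_mul_cancel₀ hp0.ne', Real.rpow_one]
  -- `r = 2 ^ (2 / p - 1)` is below `1` because `p > 2`. Since `s ^ (p - 2) * r = 1`, each summand
  -- factors as `(s ^ k * A k) ^ (p - 2) * (r ^ k * B k)`.
  set r : ℝ := s ^ 2 / 2 with hr
  have hrpos : 0 < r := by positivity
  have hr1 : r < 1 := by
    rw [hr, div_lt_one two_pos]
    have : s ^ 2 = 2 ^ (2 / p) := by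
      rw [hs, ← Real.rpow_natCast, ← Real.rpow_mul (by norm_num)]
      congr 1; push_cast; field_simp
    rw [this]
    calc (2 : ℝ) ^ (2 / p) < 2 ^ (1 : ℝ) :=
          Real.rpow_lt_rpow_of_exponent_lt one_lt_two ((div_lt_one hp0).2 hp)
      _ = 2 := Real.rpow_one 2
  obtain ⟨C, hC, hrec⟩ := exists_sum_rpow_le_of_contraction (q := p / 2) (by linarith)
    hrpos.le hr1
  refine ⟨1 + C * 2, by positivity, fun A H hA hH K => ?_⟩
  set B : ℕ → ℝ := fun k => ∑ j ∈ Finset.range (k + 1), 2 ^ j * A j ^ 2 with hB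
  have hB0 : ∀ k, 0 ≤ B k := fun k =>
    Finset.sum_nonneg fun j _ => by have := hA j; positivity
  have hsq : ∀ x : ℝ, 0 ≤ x → (x ^ 2) ^ (p / 2) = x ^ p := fun x hx => by
    rw [← Real.rpow_natCast x 2, ← Real.rpow_mul hx]; congr 1; push_cast; ring
  have hscale : ∀ (k : ℕ) (x : ℝ), 0 ≤ x → (s ^ k * x) ^ p = 2 ^ k * x ^ p := by
    intro k x hx
    rw [Real.mul_rpow (by positivity) hx, ← Real.rpow_natCast s k, ← Real.rpow_mul hspos.le,
      mul_comm (k : ℝ) p, Real.rpow_mul hspos.le, hs1, Real.rpow_natCast]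
  have key := hrec (fun k => r ^ k * B k) (fun k => (s ^ (k + 1) * A (k + 1)) ^ 2)
    (fun k => mul_nonneg (by positivity) (hB0 k)) (fun k => by positivity)
    (fun k => by
      simp only [hB]
      rw [Finset.sum_range_succ _ (k + 1)]
      refine le_of_eq ?_
      rw [mul_add]
      congr 1
      · ring
      · rw [hr, div_pow]; field_simp; ring) K
  have hsA : ∀ k, 0 ≤ s ^ k * A k := fun k => mul_nonneg (by positivity) (hA k)
  have hlast : ∀ k, A k ^ (p - 2) * B k = (s ^ k * A k) ^ (p - 2) * (r ^ k * B k) := by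
    intro k
    rw [Real.mul_rpow (by positivity) (hA k), ← Real.rpow_natCast s k, ← Real.rpow_mul hspos.le,
      mul_comm (k : ℝ) (p - 2), Real.rpow_mul hspos.le, Real.rpow_natCast,
      Real.rpow_sub hspos, hs1, hr, Real.rpow_two]
    have : (2 / s ^ 2 : ℝ) ^ k * (s ^ 2 / 2) ^ k = 1 := by
      rw [← mul_pow]; field_simp; simp
    linear_combination (-(A k ^ (p - 2) * B k)) * this
  simp only [hsq _ (hsA _), hscale _ _ (hA _), pow_zero, one_mul] at key
  have hB00 : B 0 = A 0 ^ 2 := by simp [hB]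
  rw [hB00, hsq _ (hA 0)] at key
  -- One extra term, since the forcing at step `k` involves `A (k + 1)`.
  have h2 := hH (K + 1)
  rw [Finset.sum_range_succ', pow_zero, one_mul] at h2
  have h3 : ∑ k ∈ Finset.range K, (r ^ k * B k) ^ (p / 2) ≤ C * 2 * H := by
    refine key.trans ?_
    rw [mul_assoc]
    gcongr
    have h4 := Real.rpow_nonneg (hA 0) p
    have h5 : 0 ≤ ∑ k ∈ Finset.range K, 2 ^ (k + 1) * A (k + 1) ^ p :=
      Finset.sum_nonneg fun k _ => by have := Real.rpow_nonneg (hA (k + 1)) p; positivity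
    linarith
  calc ∑ k ∈ Finset.range K, A k ^ (p - 2) * B k
      ≤ ∑ k ∈ Finset.range K, (2 ^ k * A k ^ p + (r ^ k * B k) ^ (p / 2)) := by
        refine Finset.sum_le_sum fun k _ => ?_
        rw [hlast, ← hscale k _ (hA k)]
        exact rpow_sub_two_mul_le hp (hsA k) (mul_nonneg (by positivity) (hB0 k))
    _ ≤ _ := by
        rw [Finset.sum_add_distrib, add_mul, one_mul]
        exact add_le_add (hH K) h3

/-- Real interpolation between `ℓ^∞` and `ℓ²`: if for each `k` the sequence `v` is the sum of a part
bounded by `A k` and a part whose `ℓ²` norm is controlled by `A 0, …, A k`, then `v ∈ ℓ^p`. -/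
theorem exists_tsum_rpow_le_of_decomposition {p : ℝ} (hp : 2 < p) {C₁ M : ℝ} (hC₁ : 0 ≤ C₁) :
    ∃ C : ℝ, 0 ≤ C ∧ ∀ (A : ℕ → ℝ) (H : ℝ) (v : ℤ → ℝ) (w : ℕ → ℤ → ℝ), (∀ k, 0 ≤ A k) →
      (∀ K, ∑ k ∈ Finset.range K, 2 ^ k * A k ^ p ≤ H) →
      (∀ k, A k ≤ 2 * A (k + 1)) → (∀ n, 0 ≤ v n) → (∀ n, v n ≤ M * A 0) →
      (∀ k n, v n ≤ A k + w k n) →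
      (∀ k (T : Finset ℤ), ∑ n ∈ T, w k n ^ 2 ≤
        C₁ * ∑ j ∈ Finset.range (k + 1), 2 ^ j * A j ^ 2) →
      ∑' n, v n ^ p ≤ C * H := by
  obtain ⟨C, hC, hsum⟩ := exists_sum_rpow_mul_sum_sq_le hp
  -- `M` serves when the first admissible level is `0`; otherwise minimality gives `v n ≤ 2 * A k ≤
  -- 4 * A (k + 1)`.
  set L := max M 4 with hL
  have hL0 : 0 ≤ L := le_trans (by norm_num) (le_max_right M 4)
  refine ⟨L ^ (p - 2) * 4 * C₁ * C, by positivity,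
    fun A H v w hA hH hAA hv hvM hvw hw => ?_⟩
  have hH0 : 0 ≤ H := by simpa using hH 0
  have hterm : ∀ k, 2 ^ k * A k ^ p ≤ H := fun k => by
    refine le_trans ?_ (hH (k + 1))
    exact Finset.single_le_sum (f := fun k => 2 ^ k * A k ^ p)
      (fun j _ => by have := Real.rpow_nonneg (hA j) p; positivity) (Finset.self_mem_range_succ k)
  -- The bound `2 ^ k * A k ^ p ≤ H` forces `A k` to tend to `0`.
  have hex : ∀ n, 0 < v n → ∃ k, 2 * A k < v n := by
    intro n hn
    by_contra! hcon
    have h1 : 0 < (v n / 2) ^ p := Real.rpow_pos_of_pos (by linarith) p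
    obtain ⟨k, hk⟩ := pow_unbounded_of_one_lt (H / (v n / 2) ^ p) one_lt_two
    rw [div_lt_iff₀ h1] at hk
    have h2 : (v n / 2) ^ p ≤ A k ^ p :=
      Real.rpow_le_rpow (by linarith) (by linarith [hcon k]) (by linarith)
    have h3 : (2 : ℝ) ^ k * (v n / 2) ^ p ≤ 2 ^ k * A k ^ p := by gcongr
    linarith [hterm k]
  have hlev : ∀ n, 0 < v n → ∃ k, 2 * A k < v n ∧ v n ≤ L * A k := by
    intro n hn
    classical
    refine ⟨Nat.find (hex n hn), Nat.find_spec (hex n hn), ?_⟩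
    rcases hk : Nat.find (hex n hn) with _ | k
    · refine (hvM n).trans ?_
      have := hA 0
      gcongr
      exact le_max_left _ _
    · have h1 := Nat.find_min (hex n hn) (m := k) (by omega)
      have h2 := hA (k + 1)
      have h3 : 4 * A (k + 1) ≤ L * A (k + 1) := by gcongr; exact le_max_right _ _
      linarith [hAA k]
  choose! lev hlev1 hlev2 using hlev
  have hvpow : ∀ n, 0 < v n →
      v n ^ p ≤ L ^ (p - 2) * 4 * (A (lev n) ^ (p - 2) * w (lev n) n ^ 2) := by
    intro n hn
    have h1 : v n ^ p = v n ^ (p - 2) * v n ^ 2 := by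
      rw [← Real.rpow_natCast (v n) 2, ← Real.rpow_add hn]; norm_num
    have h2 : v n ≤ 2 * w (lev n) n := by linarith [hvw (lev n) n, hlev1 n hn]
    rw [h1]
    calc v n ^ (p - 2) * v n ^ 2
        ≤ (L * A (lev n)) ^ (p - 2) * (2 * w (lev n) n) ^ 2 := by
          have := hA (lev n)
          gcongr
          exact hlev2 n hn
      _ = _ := by rw [Real.mul_rpow hL0 (hA _)]; ring
  refine Real.tsum_le_of_sum_le (fun n => Real.rpow_nonneg (hv n) p) fun T => ?_
  classical
  set T' := T.filter fun n => 0 < v n with hT'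
  have hTT : ∑ n ∈ T, v n ^ p = ∑ n ∈ T', v n ^ p := by
    refine (Finset.sum_filter_of_ne fun n _ hne => ?_).symm
    refine lt_of_le_of_ne (hv n) fun h0 => hne ?_
    rw [← h0, Real.zero_rpow (by linarith)]
  set K := T'.sup lev + 1 with hK
  have hmaps : ∀ n ∈ T', lev n ∈ Finset.range K := fun n hn =>
    Finset.mem_range.2 (Nat.lt_succ_of_le (Finset.le_sup hn))
  rw [hTT, ← Finset.sum_fiberwise_of_maps_to hmaps]
  calc ∑ k ∈ Finset.range K, ∑ n ∈ T' with lev n = k, v n ^ p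
      ≤ ∑ k ∈ Finset.range K, L ^ (p - 2) * 4 * C₁ *
          (A k ^ (p - 2) * ∑ j ∈ Finset.range (k + 1), 2 ^ j * A j ^ 2) := by
        refine Finset.sum_le_sum fun k _ => ?_
        calc ∑ n ∈ T' with lev n = k, v n ^ p
            ≤ ∑ n ∈ T' with lev n = k, L ^ (p - 2) * 4 * A k ^ (p - 2) * w k n ^ 2 := by
              refine Finset.sum_le_sum fun n hn => ?_
              obtain ⟨hn1, rfl⟩ := Finset.mem_filter.1 hn
              refine (hvpow n (Finset.mem_filter.1 hn1).2).trans (le_of_eq (by ring))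
          _ = L ^ (p - 2) * 4 * A k ^ (p - 2) * ∑ n ∈ T' with lev n = k, w k n ^ 2 :=
              Finset.mul_sum _ _ _ |>.symm
          _ ≤ L ^ (p - 2) * 4 * A k ^ (p - 2) *
                (C₁ * ∑ j ∈ Finset.range (k + 1), 2 ^ j * A j ^ 2) := by
              have := Real.rpow_nonneg (hA k) (p - 2)
              gcongr
              exact hw k _
          _ = _ := by ring
    _ = L ^ (p - 2) * 4 * C₁ * ∑ k ∈ Finset.range K,
          (A k ^ (p - 2) * ∑ j ∈ Finset.range (k + 1), 2 ^ j * A j ^ 2) :=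
        (Finset.mul_sum _ _ _).symm
    _ ≤ L ^ (p - 2) * 4 * C₁ * (C * H) := by
        gcongr
        exact hsum A H hA hH K
    _ = _ := by ring

/-! ### Distribution functions and the mass of the rearrangement. -/

/-- The distribution function of `|f|`. -/
def distr (f : ℝ → ℂ) (t : ℝ) : ENNReal := volume {y | t < ‖f y‖}

theorem antitone_distr (f : ℝ → ℂ) : Antitone (distr f) := fun _ _ h =>
  measure_mono fun _ hy => lt_of_le_of_lt h hy

theorem measurable_distr (f : ℝ → ℂ) : Measurable (distr f) := (antitone_distr f).measurable

/-- The integral of `|f|^*` over the ball of radius `r`, in terms of the distribution function. -/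
def topMass (f : ℝ → ℂ) (r : ENNReal) : ENNReal :=
  ∫⁻ t in Set.Ioi (0 : ℝ), min (distr f t) (2 * r)

theorem measurable_indicator_setRearr (f : ℝ → ℂ) :
    Measurable fun z : ℝ × ℝ =>
      (setRearr {y | z.2 < ‖f y‖}).indicator (fun _ => (1 : ENNReal)) z.1 := by
  have hset : MeasurableSet {z : ℝ × ℝ | edist z.1 0 < distr f z.2 / 2} :=
    measurableSet_lt (by fun_prop)
      (((measurable_distr f).comp measurable_snd).div_const 2)
  exact (measurable_const (a := (1 : ENNReal))).indicator hset

theorem measurable_symmDecrRearr (f : ℝ → ℂ) : Measurable (symmDecrRearr f) :=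
  (measurable_indicator_setRearr f).lintegral_prod_right'

/-- Tonelli: at each height the two concentric balls meet in the smaller one. -/
theorem setLIntegral_symmDecrRearr (f : ℝ → ℂ) (r : ENNReal) :
    ∫⁻ x in Metric.eball 0 r, symmDecrRearr f x = topMass f r := by
  unfold symmDecrRearr topMass
  rw [lintegral_lintegral_swap (measurable_indicator_setRearr f).aemeasurable]
  refine lintegral_congr fun t => ?_
  have hm : MeasurableSet (setRearr {y | t < ‖f y‖}) := Metric.isOpen_eball.measurableSet
  rw [lintegral_indicator hm, lintegral_one, Measure.restrict_apply_univ,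
    Measure.restrict_apply hm]
  have hinter : setRearr {y | t < ‖f y‖} ∩ Metric.eball 0 r =
      Metric.eball 0 (min (distr f t / 2) r) := by
    ext x
    simp [setRearr, distr, Metric.mem_eball]
  rw [hinter, Real.volume_eball, mul_min, ENNReal.mul_div_cancel (by simp) (by simp)]

/-- The superlevel sets of the rearrangement are no larger than those of the function. -/
theorem volume_lt_symmDecrRearr_le (f : ℝ → ℂ) (t : ℝ) :
    volume {x | ENNReal.ofReal t < symmDecrRearr f x} ≤ distr f t := by
  have hsub : {x | ENNReal.ofReal t < symmDecrRearr f x} ⊆ setRearr {y | t < ‖f y‖} := by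
    intro x hx
    by_contra hcon
    refine absurd (show ENNReal.ofReal t < symmDecrRearr f x from hx) (not_lt.2 ?_)
    -- The balls shrink as the height grows, so a point outside the ball at height `t` is only in
    -- balls of height below `t`.
    have hle : ∀ s ∈ Set.Ioi (0 : ℝ),
        (setRearr {y | s < ‖f y‖}).indicator (fun _ => (1 : ENNReal)) x ≤
          (Set.Ioo 0 t).indicator (fun _ => 1) s := by
      intro s hs
      by_cases hst : s < t
      · rw [Set.indicator_of_mem (show s ∈ Set.Ioo 0 t from ⟨hs, hst⟩)]
        exact Set.indicator_le_self' (fun _ _ => zero_le) x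
      · rw [Set.indicator_of_notMem]
        · exact zero_le
        · intro hmem
          refine hcon (Metric.eball_subset_eball ?_ hmem)
          gcongr
          exact not_lt.1 hst
    calc symmDecrRearr f x ≤ ∫⁻ s in Set.Ioi (0 : ℝ), (Set.Ioo 0 t).indicator (fun _ => 1) s :=
          setLIntegral_mono' measurableSet_Ioi hle
      _ ≤ ∫⁻ s, (Set.Ioo 0 t).indicator (fun _ => 1) s := setLIntegral_le_lintegral _ _
      _ = ENNReal.ofReal t := by
          rw [lintegral_indicator measurableSet_Ioo, lintegral_one, Measure.restrict_apply_univ,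
            Real.volume_Ioo, sub_zero]
  exact (measure_mono hsub).trans (volume_setRearr _).le

theorem topMass_two_mul_le (f : ℝ → ℂ) (r : ENNReal) : topMass f (2 * r) ≤ 2 * topMass f r := by
  unfold topMass
  rw [← lintegral_const_mul' _ _ (by simp)]
  refine lintegral_mono fun t => ?_
  rw [mul_min]
  refine min_le_min (le_mul_of_one_le_left zero_le (by norm_num)) (le_of_eq (by ring))

/-- The integrand of `topMass` equals `2 * r` on all of `(0, t)`. -/
theorem ofReal_mul_le_topMass (f : ℝ → ℂ) {r : ENNReal} {t : ℝ} (h : 2 * r ≤ distr f t) :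
    ENNReal.ofReal t * (2 * r) ≤ topMass f r := by
  calc ENNReal.ofReal t * (2 * r) = ∫⁻ _ in Set.Ioo 0 t, 2 * r := by
        rw [setLIntegral_const, Real.volume_Ioo, sub_zero, mul_comm]
    _ ≤ ∫⁻ s in Set.Ioo 0 t, min (distr f s) (2 * r) :=
        setLIntegral_mono' measurableSet_Ioo fun s hs =>
          le_min (h.trans (antitone_distr f hs.2.le)) le_rfl
    _ ≤ topMass f r := lintegral_mono_set Set.Ioo_subset_Ioi_self

theorem lintegral_enorm_eq_distr {f : ℝ → ℂ} (hf : AEStronglyMeasurable f) :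
    ∫⁻ x, ‖f x‖ₑ = ∫⁻ t in Set.Ioi (0 : ℝ), distr f t := by
  simp_rw [← ofReal_norm]
  exact lintegral_eq_lintegral_meas_lt volume (Filter.Eventually.of_forall fun x => norm_nonneg _)
    hf.norm.aemeasurable

theorem topMass_le_lintegral {f : ℝ → ℂ} (hf : AEStronglyMeasurable f) (r : ENNReal) :
    topMass f r ≤ ∫⁻ x, ‖f x‖ₑ := by
  rw [lintegral_enorm_eq_distr hf]
  exact lintegral_mono fun t => min_le_left _ _

/-- The part of `f` above a level attained on a set of measure at most `2 * r`. -/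
theorem lintegral_indicator_le_topMass {f : ℝ → ℂ} (hf : AEStronglyMeasurable f) {r : ENNReal}
    {t : ℝ} (hs : MeasurableSet {y | t < ‖f y‖}) (h : distr f t ≤ 2 * r) :
    ∫⁻ x, ‖{y | t < ‖f y‖}.indicator f x‖ₑ ≤ topMass f r := by
  rw [lintegral_enorm_eq_distr (hf.indicator hs)]
  refine setLIntegral_mono' measurableSet_Ioi fun s hs0 => le_min ?_ (le_trans ?_ h)
  · refine measure_mono fun y hy => ?_
    change s < ‖f y‖
    exact lt_of_lt_of_le hy (norm_indicator_le_norm_self _ _)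
  · refine measure_mono fun y hy => ?_
    by_contra hcon
    simp only [Set.mem_ofPred_eq, Set.indicator_of_notMem hcon, norm_zero] at hy
    exact absurd hs0 (not_lt.2 hy.le)

/-- The symmetric decreasing rearrangement of a square integrable function is square integrable. -/
theorem lintegral_symmDecrRearr_sq_le {f : ℝ → ℂ} (hf : AEStronglyMeasurable f) :
    ∫⁻ x, ENNReal.ofReal ((symmDecrRearr f x).toReal ^ 2) ≤ ∫⁻ x, ENNReal.ofReal (‖f x‖ ^ 2) := by
  have h1 := lintegral_rpow_eq_lintegral_meas_lt_mul volume
    (f := fun x => (symmDecrRearr f x).toReal)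
    (Filter.Eventually.of_forall fun x => ENNReal.toReal_nonneg)
    (measurable_symmDecrRearr f).ennreal_toReal.aemeasurable two_pos
  have h2 := lintegral_rpow_eq_lintegral_meas_lt_mul volume (f := fun x => ‖f x‖)
    (Filter.Eventually.of_forall fun x => norm_nonneg _) hf.norm.aemeasurable two_pos
  simp only [Real.rpow_two] at h1 h2
  rw [h1, h2]
  gcongr ENNReal.ofReal 2 * ?_
  refine setLIntegral_mono' measurableSet_Ioi fun t ht => ?_
  gcongr ?_ * _
  refine le_trans (measure_mono fun x hx => ?_) (volume_lt_symmDecrRearr_le f t)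
  exact (ENNReal.ofReal_lt_ofReal_iff_of_nonneg (le_of_lt ht)).2 hx |>.trans_le
    ENNReal.ofReal_toReal_le

/-! ### Fourier coefficients as inner products and integrals. -/

theorem inner_expLp (φ : Lp ℂ 2 circleVol) (n : ℤ) :
    inner ℂ (expLp n) φ = fourierInv φ n := by
  rw [L2.inner_def, fourierInv, ← integral_const_mul]
  refine integral_congr_ae ?_
  filter_upwards [(memLp_expFun n).coeFn_toLp] with x hn
  rw [expLp, hn, expFun, RCLike.inner_apply, map_mul, Complex.conj_ofReal, ← Complex.exp_conj]
  simp only [map_neg, map_mul, Complex.conj_I, Complex.conj_ofReal, map_intCast]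
  rw [neg_mul, neg_mul, neg_neg]
  ring

theorem fourierInv_congr {f g : ℝ → ℂ} (h : f =ᵐ[circleVol] g) (n : ℤ) :
    fourierInv f n = fourierInv g n := by
  rw [fourierInv, fourierInv]
  congr 1
  refine integral_congr_ae ?_
  filter_upwards [h] with x hx
  rw [hx]

theorem inner_expLp_toLp {f : ℝ → ℂ} (hf : MemLp f 2 circleVol) (n : ℤ) :
    inner ℂ (expLp n) (hf.toLp f) = fourierInv f n := by
  rw [inner_expLp]
  exact fourierInv_congr hf.coeFn_toLp n

theorem inner_expLp_fourierTransform (u : SqSummable) (n : ℤ) :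
    inner ℂ (expLp n) (fourierTransform u) = u n := by
  have h := (summable_fourierTransform u).hasSum.mapL (innerSL ℂ (expLp n))
  have h2 : HasSum (fun m : ℤ => innerSL ℂ (expLp n) (u m • expLp m)) (u n) := by
    convert hasSum_ite_eq n (u n) using 2 with m
    simp only [innerSL_apply_apply, inner_smul_right, orthonormal_iff_ite.1 orthonormal_expLp n m]
    split_ifs with h1 h2 h2
    · simp [h1]
    · exact absurd h1.symm h2
    · exact absurd h2.symm h1
    · simp
  exact h.unique h2

theorem inv_sqrt_two_pi_le_one : (Real.sqrt (2 * Real.pi))⁻¹ ≤ 1 :=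
  inv_le_one_of_one_le₀ (Real.one_le_sqrt.2 (by linarith [Real.pi_gt_three]))

theorem norm_exp_I_int_mul (n : ℤ) (x : ℝ) : ‖Complex.exp (Complex.I * n * x)‖ = 1 := by
  have h : Complex.I * n * x = ((n * x : ℝ) : ℂ) * Complex.I := by push_cast; ring
  rw [h, Complex.norm_exp_ofReal_mul_I]

theorem norm_fourierInv_le (f : ℝ → ℂ) (n : ℤ) :
    ‖fourierInv f n‖ ≤ ∫ x, ‖f x‖ ∂circleVol := by
  rw [fourierInv, norm_mul, Complex.norm_real, Real.norm_of_nonneg (by positivity)]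
  refine (mul_le_of_le_one_left (norm_nonneg _) inv_sqrt_two_pi_le_one).trans ?_
  refine (norm_integral_le_integral_norm _).trans (le_of_eq ?_)
  simp_rw [norm_mul, norm_exp_I_int_mul, mul_one]

theorem integrable_mul_exp {f : ℝ → ℂ} (hf : Integrable f circleVol) (n : ℤ) :
    Integrable (fun x : ℝ => f x * Complex.exp (Complex.I * n * x)) circleVol :=
  hf.mul_bdd (c := 1) (by fun_prop)
    (Filter.Eventually.of_forall fun x => (norm_exp_I_int_mul n x).le)

theorem fourierInv_add {f g : ℝ → ℂ} (hf : Integrable f circleVol) (hg : Integrable g circleVol)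
    (n : ℤ) : fourierInv (f + g) n = fourierInv f n + fourierInv g n := by
  simp only [fourierInv, Pi.add_apply, add_mul]
  rw [integral_add (integrable_mul_exp hf n) (integrable_mul_exp hg n), mul_add]

/-! ### The Fejér kernel and means near the origin. -/

/-- The unnormalised Fejér kernel. -/
def fejer (N : ℕ) (x : ℝ) : ℝ := ‖∑ j ∈ Finset.range N, Complex.exp (Complex.I * (j : ℤ) * x)‖ ^ 2

theorem fejer_eq_sum (N : ℕ) (x : ℝ) :
    (fejer N x : ℂ) = ∑ j ∈ Finset.range N, ∑ l ∈ Finset.range N,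
      Complex.exp (Complex.I * ((j - l : ℤ) : ℤ) * x) := by
  rw [fejer, Complex.ofReal_pow, ← Complex.mul_conj', map_sum, Finset.sum_mul_sum]
  refine Finset.sum_congr rfl fun j _ => Finset.sum_congr rfl fun l _ => ?_
  rw [← Complex.exp_conj, ← Complex.exp_add]
  congr 1
  simp only [map_mul, Complex.conj_I, Complex.conj_ofReal, map_intCast]
  push_cast
  ring

/-- Every phase `j * x` has modulus at most `1`, so each exponential has real part at least `1 / 2`.
-/
theorem sq_div_four_le_fejer {N : ℕ} {x : ℝ} (hx : |x| * N ≤ 1) : (N : ℝ) ^ 2 / 4 ≤ fejer N x := by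
  have h1 : (N : ℝ) / 2 ≤ ‖∑ j ∈ Finset.range N, Complex.exp (Complex.I * (j : ℤ) * x)‖ := by
    refine le_trans ?_ (Complex.re_le_norm _)
    rw [Complex.re_sum]
    have h2 : ∀ j ∈ Finset.range N,
        (1 / 2 : ℝ) ≤ (Complex.exp (Complex.I * (j : ℤ) * x)).re := by
      intro j hj
      have h : Complex.I * (j : ℤ) * x = ((j * x : ℝ) : ℂ) * Complex.I := by push_cast; ring
      rw [h, Complex.exp_ofReal_mul_I_re]
      refine le_trans ?_ Real.one_sub_sq_div_two_le_cos
      have h3 : |(j : ℝ) * x| ≤ 1 := by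
        rw [abs_mul, Nat.abs_cast, mul_comm]
        refine le_trans ?_ hx
        gcongr
        exact (Finset.mem_range.1 hj).le
      have h4 : ((j : ℝ) * x) ^ 2 ≤ 1 := (sq_le_one_iff_abs_le_one _).2 h3
      linarith
    have h5 := Finset.card_nsmul_le_sum _ _ _ h2
    rw [Finset.card_range, nsmul_eq_mul] at h5
    linarith
  have h6 := pow_le_pow_left₀ (by positivity) h1 2
  rw [fejer]
  linarith

/-- In the double sum of coefficients at `j - l`, each fixed `j` visits distinct frequencies in
`(-N, N)`, so the window is counted at most `N` times. -/
theorem integral_mul_fejer_le {g : ℝ → ℝ} (hg : Integrable g circleVol) (N : ℕ) :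
    ∫ x, g x * fejer N x ∂circleVol ≤
      Real.sqrt (2 * Real.pi) * (N * ∑ n ∈ Finset.Ioo (-N : ℤ) N,
        ‖fourierInv (fun x => (g x : ℂ)) n‖) := by
  have hgc : Integrable (fun x => (g x : ℂ)) circleVol := hg.ofReal
  have hs : Real.sqrt (2 * Real.pi) ≠ 0 := by positivity
  have h1 : ((∫ x, g x * fejer N x ∂circleVol : ℝ) : ℂ) =
      ∑ j ∈ Finset.range N, ∑ l ∈ Finset.range N,
        (Real.sqrt (2 * Real.pi) : ℂ) * fourierInv (fun x => (g x : ℂ)) (j - l) := by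
    rw [← integral_complex_ofReal]
    simp_rw [Complex.ofReal_mul, fejer_eq_sum, Finset.mul_sum]
    rw [integral_finsetSum _ fun j _ => integrable_finsetSum _ fun l _ =>
      integrable_mul_exp hgc _]
    refine Finset.sum_congr rfl fun j _ => ?_
    rw [integral_finsetSum _ fun l _ => integrable_mul_exp hgc _]
    refine Finset.sum_congr rfl fun l _ => ?_
    rw [fourierInv, ← mul_assoc, ← Complex.ofReal_mul, mul_inv_cancel₀ hs, Complex.ofReal_one,
      one_mul]
  calc ∫ x, g x * fejer N x ∂circleVol ≤ ‖((∫ x, g x * fejer N x ∂circleVol : ℝ) : ℂ)‖ := by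
        rw [Complex.norm_real]; exact Real.le_norm_self _
    _ ≤ ∑ j ∈ Finset.range N, ∑ l ∈ Finset.range N,
        Real.sqrt (2 * Real.pi) * ‖fourierInv (fun x => (g x : ℂ)) (j - l)‖ := by
        rw [h1]
        refine (norm_sum_le _ _).trans (Finset.sum_le_sum fun j _ => (norm_sum_le _ _).trans
          (Finset.sum_le_sum fun l _ => le_of_eq ?_))
        rw [norm_mul, Complex.norm_real, Real.norm_of_nonneg (by positivity)]
    _ ≤ ∑ j ∈ Finset.range N, Real.sqrt (2 * Real.pi) *
          ∑ n ∈ Finset.Ioo (-N : ℤ) N, ‖fourierInv (fun x => (g x : ℂ)) n‖ := by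
        refine Finset.sum_le_sum fun j hj => ?_
        rw [← Finset.mul_sum]
        gcongr
        have hinj : Set.InjOn (fun l : ℕ => (j - l : ℤ)) (Finset.range N) := by
          intro a _ b _ hab
          simp only at hab
          omega
        rw [← Finset.sum_image (f := fun n => ‖fourierInv (fun x => (g x : ℂ)) n‖) hinj]
        refine Finset.sum_le_sum_of_subset_of_nonneg ?_ fun _ _ _ => norm_nonneg _
        intro n hn
        obtain ⟨l, hl, rfl⟩ := Finset.mem_image.1 hn
        have hj := Finset.mem_range.1 hj
        have hl := Finset.mem_range.1 hl
        rw [Finset.mem_Ioo]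
        constructor <;> omega
    _ = _ := by rw [Finset.sum_const, Finset.card_range, nsmul_eq_mul]; ring

/-- The mean of a nonnegative function near the origin is controlled by the mean of its low Fourier
coefficients. -/
theorem setIntegral_ball_le {g : ℝ → ℝ} (hg0 : ∀ x, 0 ≤ g x) (hg : Integrable g circleVol)
    {N : ℕ} (hN : 0 < N) :
    ∫ x in Metric.ball 0 (N : ℝ)⁻¹, g x ≤
      4 * Real.sqrt (2 * Real.pi) * ((N : ℝ)⁻¹ * ∑ n ∈ Finset.Ioo (-N : ℤ) N,
        ‖fourierInv (fun x => (g x : ℂ)) n‖) := by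
  have hN' : (0 : ℝ) < N := by exact_mod_cast hN
  have hfc : Continuous (fejer N) := by unfold fejer; fun_prop
  have hint : Integrable (fun x => g x * fejer N x) circleVol := by
    refine hg.mul_bdd (c := N ^ 2) hfc.aestronglyMeasurable
      (Filter.Eventually.of_forall fun x => ?_)
    rw [fejer, norm_pow, norm_norm]
    gcongr
    refine (norm_sum_le _ _).trans ?_
    simp_rw [norm_exp_I_int_mul]
    simp
  have hsub : Metric.ball (0 : ℝ) (N : ℝ)⁻¹ ⊆ Set.Ioo (-Real.pi) Real.pi := by
    intro x hx
    rw [mem_ball_zero_iff, Real.norm_eq_abs] at hx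
    have h1 : (N : ℝ)⁻¹ ≤ 1 := inv_le_one_of_one_le₀ (by exact_mod_cast hN)
    have := abs_lt.1 (hx.trans_le h1)
    constructor <;> linarith [Real.pi_gt_three]
  have h1 : (N : ℝ) ^ 2 / 4 * ∫ x in Metric.ball 0 (N : ℝ)⁻¹, g x ≤
      ∫ x, g x * fejer N x ∂circleVol := by
    rw [← integral_const_mul]
    calc ∫ x in Metric.ball 0 (N : ℝ)⁻¹, (N : ℝ) ^ 2 / 4 * g x
        ≤ ∫ x in Metric.ball 0 (N : ℝ)⁻¹, g x * fejer N x := by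
          refine setIntegral_mono_on ((IntegrableOn.mono_set hg hsub).const_mul _)
            (IntegrableOn.mono_set hint hsub) Metric.isOpen_ball.measurableSet fun x hx => ?_
          rw [mul_comm]
          refine mul_le_mul_of_nonneg_left (sq_div_four_le_fejer ?_) (hg0 x)
          rw [mem_ball_zero_iff, Real.norm_eq_abs] at hx
          exact (mul_lt_mul_of_pos_right hx hN').le.trans (inv_mul_cancel₀ hN'.ne').le
      _ ≤ _ := setIntegral_mono_set hint
          (Filter.Eventually.of_forall fun x => mul_nonneg (hg0 x) (sq_nonneg _))
          hsub.eventuallyLE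
  have h2 := h1.trans (integral_mul_fejer_le hg N)
  set S := ∑ n ∈ Finset.Ioo (-N : ℤ) N, ‖fourierInv (fun x => (g x : ℂ)) n‖
  have h3 : ∫ x in Metric.ball 0 (N : ℝ)⁻¹, g x ≤
      (Real.sqrt (2 * Real.pi) * (N * S)) / ((N : ℝ) ^ 2 / 4) := by
    rw [le_div_iff₀ (by positivity), mul_comm]
    exact h2
  refine h3.trans (le_of_eq ?_)
  field_simp

/-! ### Bessel's inequality and summability. -/

theorem sum_norm_fourierInv_sq_le {f : ℝ → ℂ} (hf : MemLp f 2 circleVol) (T : Finset ℤ) :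
    ∑ n ∈ T, ‖fourierInv f n‖ ^ 2 ≤ ∫ x, ‖f x‖ ^ 2 ∂circleVol := by
  have h1 := orthonormal_expLp.sum_inner_products_le (hf.toLp f) (s := T)
  simp_rw [inner_expLp_toLp] at h1
  refine h1.trans (le_of_eq ?_)
  have h2 : ((‖hf.toLp f‖ ^ 2 : ℝ) : ℂ) = ((∫ x, ‖f x‖ ^ 2 ∂circleVol : ℝ) : ℂ) := by
    rw [← integral_complex_ofReal, Complex.ofReal_pow]
    refine (inner_self_eq_norm_sq_to_K (𝕜 := ℂ) (hf.toLp f)).symm.trans ?_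
    rw [L2.inner_def]
    refine integral_congr_ae ?_
    filter_upwards [hf.coeFn_toLp] with x hx
    rw [hx, inner_self_eq_norm_sq_to_K, Complex.ofReal_pow]
    rfl
  exact_mod_cast h2

theorem summable_norm_fourierInv_sq {f : ℝ → ℂ} (hf : MemLp f 2 circleVol) :
    Summable fun n => ‖fourierInv f n‖ ^ 2 :=
  summable_of_sum_le (fun _ => sq_nonneg _) (sum_norm_fourierInv_sq_le hf)

theorem summable_rpow_of_summable_sq {a : ℤ → ℝ} (ha : ∀ n, 0 ≤ a n)
    (h : Summable fun n => a n ^ 2) {p : ℝ} (hp : 2 < p) : Summable fun n => a n ^ p := by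
  refine summable_of_isBigO h ?_
  refine Asymptotics.IsBigO.of_bound 1 ?_
  have h1 : ∀ᶠ n in Filter.cofinite, a n ^ 2 < 1 :=
    h.tendsto_cofinite_zero.eventually (gt_mem_nhds one_pos)
  filter_upwards [h1] with n hn
  have h2 : a n ≤ 1 := by nlinarith [ha n]
  rw [one_mul, Real.norm_of_nonneg (Real.rpow_nonneg (ha n) p),
    Real.norm_of_nonneg (sq_nonneg _), ← Real.rpow_two]
  exact Real.rpow_le_rpow_of_exponent_ge_of_imp (ha n) h2 hp.le (by intro _ h0; linarith)

/-! ### Dyadic masses and truncation at their levels. -/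

/-- The mass of `f^*` on the interval `(-2⁻ᵏ, 2⁻ᵏ)`. -/
def dyadicMass (f : ℝ → ℂ) (k : ℕ) : ℝ := (topMass f (2 ^ k)⁻¹).toReal

theorem dyadicMass_nonneg (f : ℝ → ℂ) (k : ℕ) : 0 ≤ dyadicMass f k := ENNReal.toReal_nonneg

section

variable {f : ℝ → ℂ}

theorem topMass_ne_top (hf : Integrable f) (r : ENNReal) : topMass f r ≠ ⊤ :=
  ((topMass_le_lintegral hf.1 r).trans_lt hf.2).ne

theorem ofReal_dyadicMass (hf : Integrable f) (k : ℕ) :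
    ENNReal.ofReal (dyadicMass f k) = topMass f (2 ^ k)⁻¹ :=
  ENNReal.ofReal_toReal (topMass_ne_top hf _)

theorem dyadicMass_le_two_mul (hf : Integrable f) (k : ℕ) :
    dyadicMass f k ≤ 2 * dyadicMass f (k + 1) := by
  have h := topMass_two_mul_le f (2 ^ (k + 1))⁻¹
  have h2 : (2 : ENNReal) * (2 ^ (k + 1))⁻¹ = (2 ^ k)⁻¹ := by
    rw [pow_succ, ENNReal.mul_inv (by simp) (by simp), mul_left_comm,
      ENNReal.mul_inv_cancel (by simp) (by simp), mul_one]
  rw [h2] at h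
  have h3 := ENNReal.toReal_mono (ENNReal.mul_ne_top (by simp) (topMass_ne_top hf _)) h
  rwa [ENNReal.toReal_mul, ENNReal.toReal_ofNat] at h3

/-- A Chebyshev argument: otherwise the mass would be at least height times length, `2 * dyadicMass
f k`, contradicting positivity. -/
theorem distr_two_pow_mul_dyadicMass_le (hf : Integrable f) {k : ℕ} (hk : 0 < dyadicMass f k) :
    distr f (2 ^ k * dyadicMass f k) ≤ 2 * (2 ^ k)⁻¹ := by
  by_contra! hcon
  have h := ofReal_mul_le_topMass f hcon.le
  rw [← ofReal_dyadicMass hf, ENNReal.ofReal_mul (by positivity),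
    ENNReal.ofReal_pow (by norm_num), ENNReal.ofReal_ofNat] at h
  have h2 : (2 : ENNReal) ^ k * ENNReal.ofReal (dyadicMass f k) * (2 * (2 ^ k)⁻¹) =
      ENNReal.ofReal (2 * dyadicMass f k) := by
    rw [ENNReal.ofReal_mul (by norm_num), ENNReal.ofReal_ofNat]
    calc _ = (2 ^ k * (2 ^ k)⁻¹) * (2 * ENNReal.ofReal (dyadicMass f k)) := by ring
      _ = _ := by rw [ENNReal.mul_inv_cancel (by simp) (by simp), one_mul]
  rw [h2, ENNReal.ofReal_le_ofReal_iff hk.le] at h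
  linarith

/-- The support has measure at most `2 * π < 8`, four times the length of `(-1, 1)`. -/
theorem lintegral_enorm_le_four_mul (hf : Integrable f)
    (hsupp : ∀ x, x ∉ Set.Ioo (-Real.pi) Real.pi → f x = 0) :
    ∫⁻ x, ‖f x‖ₑ ≤ ENNReal.ofReal (4 * dyadicMass f 0) := by
  rw [lintegral_enorm_eq_distr hf.1, ENNReal.ofReal_mul (by norm_num), ofReal_dyadicMass hf,
    topMass, ENNReal.ofReal_ofNat, ← lintegral_const_mul' _ _ (by simp)]
  refine setLIntegral_mono' measurableSet_Ioi fun t ht => ?_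
  rw [mul_min]
  refine le_min (le_mul_of_one_le_left zero_le (by norm_num)) ?_
  calc distr f t ≤ volume (Set.Ioo (-Real.pi) Real.pi) := by
        refine measure_mono fun x hx => ?_
        by_contra hcon
        have hx' : t < ‖f x‖ := hx
        rw [hsupp x hcon, norm_zero] at hx'
        exact absurd ht (not_lt.2 hx'.le)
    _ ≤ ENNReal.ofReal 8 := by
        rw [Real.volume_Ioo]
        exact ENNReal.ofReal_le_ofReal (by linarith [Real.pi_lt_four])
    _ = _ := by
        rw [pow_zero, inv_one, ENNReal.ofReal_ofNat]; norm_num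

theorem integral_norm_circleVol_le {h : ℝ → ℂ} (hm : AEStronglyMeasurable h) {B : ℝ} (hB : 0 ≤ B)
    (hle : ∫⁻ x, ‖h x‖ₑ ≤ ENNReal.ofReal B) : ∫ x, ‖h x‖ ∂circleVol ≤ B := by
  rw [integral_norm_eq_lintegral_enorm hm.restrict]
  exact ENNReal.toReal_le_of_le_ofReal hB ((setLIntegral_le_lintegral _ _).trans hle)

/-- Either `y ≤ t 0`, or some `j < k` has `t j < y ≤ t (j + 1)`; monotone levels are not needed. -/
theorem sq_le_sum_of_le {t : ℕ → ℝ} {y : ℝ} (hy : 0 ≤ y) (k : ℕ) (h : y ≤ t k) :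
    y ^ 2 ≤ t 0 ^ 2 + ∑ j ∈ Finset.range k, (Set.Ioi (t j)).indicator (fun _ => t (j + 1) ^ 2) y := by
  induction k with
  | zero => simpa using pow_le_pow_left₀ hy h 2
  | succ k ih =>
    rw [Finset.sum_range_succ]
    by_cases hk : y ≤ t k
    · have h1 : 0 ≤ (Set.Ioi (t k)).indicator (fun _ => t (k + 1) ^ 2) y :=
        Set.indicator_nonneg (fun _ _ => sq_nonneg _) _
      linarith [ih hk]
    · have h0 : 0 ≤ ∑ j ∈ Finset.range k, (Set.Ioi (t j)).indicator (fun _ => t (j + 1) ^ 2) y :=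
        Finset.sum_nonneg fun j _ => Set.indicator_nonneg (fun _ _ => sq_nonneg _) _
      rw [Set.indicator_of_mem (show y ∈ Set.Ioi (t k) from not_le.1 hk)]
      have := pow_le_pow_left₀ hy h 2
      nlinarith [sq_nonneg (t 0)]

/-- The energy of the part of `f` below the `k`-th level. -/
theorem integral_sq_below_level_le (hfm : StronglyMeasurable f) (hf : Integrable f)
    (hpos : ∀ k, 0 < dyadicMass f k) (k : ℕ) :
    ∫ x, ‖{y | 2 ^ k * dyadicMass f k < ‖f y‖}ᶜ.indicator f x‖ ^ 2 ∂circleVol ≤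
      8 * ∑ j ∈ Finset.range (k + 1), 2 ^ j * dyadicMass f j ^ 2 := by
  set t : ℕ → ℝ := fun j => 2 ^ j * dyadicMass f j with ht
  have hms : ∀ s : ℝ, MeasurableSet {y | s < ‖f y‖} := fun s =>
    measurableSet_lt measurable_const hfm.norm.measurable
  set E : ℕ → Set ℝ := fun j => {y | t j < ‖f y‖} with hE
  have hmE : ∀ j, MeasurableSet (E j) := fun j => hms (t j)
  have hpt : ∀ x, ‖(E k)ᶜ.indicator f x‖ ^ 2 ≤
      t 0 ^ 2 + ∑ j ∈ Finset.range k, (E j).indicator (fun _ => t (j + 1) ^ 2) x := by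
    intro x
    by_cases hx : t k < ‖f x‖
    · rw [Set.indicator_of_notMem (Set.notMem_compl_iff.2 (show x ∈ E k from hx)), norm_zero]
      have : 0 ≤ ∑ j ∈ Finset.range k, (E j).indicator (fun _ => t (j + 1) ^ 2) x :=
        Finset.sum_nonneg fun j _ => Set.indicator_nonneg (fun _ _ => sq_nonneg _) _
      nlinarith [sq_nonneg (t 0)]
    · rw [Set.indicator_of_mem (show x ∈ (E k)ᶜ from hx)]
      exact sq_le_sum_of_le (norm_nonneg _) k (not_lt.1 hx)
  have hint : ∀ j, Integrable ((E j).indicator fun _ => t (j + 1) ^ 2) circleVol := fun j =>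
    (integrable_const _).indicator (hmE j)
  have hmeas : ∀ j, circleVol.real (E j) ≤ 2 * (2 ^ j)⁻¹ := by
    intro j
    have h1 : circleVol (E j) ≤ 2 * (2 ^ j)⁻¹ :=
      (Measure.restrict_apply_le _ _).trans (distr_two_pow_mul_dyadicMass_le hf (hpos j))
    have h2 := ENNReal.toReal_mono (by finiteness) h1
    simpa [Measure.real] using h2
  calc ∫ x, ‖(E k)ᶜ.indicator f x‖ ^ 2 ∂circleVol
      ≤ ∫ x, (t 0 ^ 2 + ∑ j ∈ Finset.range k, (E j).indicator (fun _ => t (j + 1) ^ 2) x)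
          ∂circleVol :=
        integral_mono_of_nonneg (Filter.Eventually.of_forall fun x => sq_nonneg _)
          ((integrable_const _).add (integrable_finsetSum _ fun j _ => hint j))
          (Filter.Eventually.of_forall hpt)
    _ = 2 * Real.pi * t 0 ^ 2 +
          ∑ j ∈ Finset.range k, circleVol.real (E j) * t (j + 1) ^ 2 := by
        rw [integral_add (integrable_const _) (integrable_finsetSum _ fun j _ => hint j),
          integral_const, integral_finsetSum _ fun j _ => hint j]
        congr 1
        · rw [smul_eq_mul, measureReal_restrict_apply_univ, Real.volume_real_Ioo_of_le
            (by linarith [Real.pi_pos])]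
          ring
        · refine Finset.sum_congr rfl fun j _ => ?_
          rw [integral_indicator_const _ (hmE j), smul_eq_mul]
    _ ≤ 8 * t 0 ^ 2 + ∑ j ∈ Finset.range k, 2 * (2 ^ j)⁻¹ * t (j + 1) ^ 2 := by
        gcongr with j
        · linarith [Real.pi_lt_four]
        · exact hmeas j
    _ ≤ _ := by
        rw [Finset.sum_range_succ', mul_add, add_comm, Finset.mul_sum]
        have h0 : t 0 ^ 2 = 2 ^ 0 * dyadicMass f 0 ^ 2 := by simp [ht]
        rw [h0]
        refine add_le_add (Finset.sum_le_sum fun j _ => ?_) le_rfl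
        have h1 : 2 * (2 ^ j : ℝ)⁻¹ * t (j + 1) ^ 2 =
            4 * (2 ^ (j + 1) * dyadicMass f (j + 1) ^ 2) := by
          simp only [ht]
          field_simp
          ring
        rw [h1]
        gcongr
        norm_num

/-- The Hardy–Littlewood–Paley inequality, in terms of the masses of the rearrangement. -/
theorem exists_tsum_norm_fourierInv_rpow_le {p : ℝ} (hp : 2 < p) :
    ∃ C : ℝ, 0 ≤ C ∧ ∀ (f : ℝ → ℂ) (H : ℝ), StronglyMeasurable f → Integrable f →
      MemLp f 2 circleVol → (∀ x, x ∉ Set.Ioo (-Real.pi) Real.pi → f x = 0) →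
      (∀ K, ∑ k ∈ Finset.range K, 2 ^ k * dyadicMass f k ^ p ≤ H) →
      ∑' n, ‖fourierInv f n‖ ^ p ≤ C * H := by
  obtain ⟨C, hC, hdec⟩ := exists_tsum_rpow_le_of_decomposition hp (C₁ := 8) (M := 4) (by norm_num)
  refine ⟨C, hC, fun f H hfm hf hf2 hsupp hH => ?_⟩
  have hsup : ∀ n, ‖fourierInv f n‖ ≤ 4 * dyadicMass f 0 := fun n =>
    (norm_fourierInv_le f n).trans (integral_norm_circleVol_le hf.1
      (by linarith [dyadicMass_nonneg f 0]) (lintegral_enorm_le_four_mul hf hsupp))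
  -- Zero mass is treated apart because the level-set bound needs positive masses; doubling spreads
  -- positivity from `k = 0` to all `k`.
  rcases (dyadicMass_nonneg f 0).eq_or_lt with h0 | h0
  · have hz : ∀ n, ‖fourierInv f n‖ = 0 := fun n =>
      le_antisymm (by simpa [← h0] using hsup n) (norm_nonneg _)
    simp_rw [hz, Real.zero_rpow (show p ≠ 0 by linarith), tsum_zero]
    exact mul_nonneg hC (by simpa using hH 0)
  have hpos : ∀ k, 0 < dyadicMass f k := fun k => by
    induction k with
    | zero => exact h0
    | succ k ih => linarith [dyadicMass_le_two_mul hf k]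
  set E : ℕ → Set ℝ := fun k => {y | 2 ^ k * dyadicMass f k < ‖f y‖} with hE
  have hmE : ∀ k, MeasurableSet (E k) := fun k =>
    measurableSet_lt measurable_const hfm.norm.measurable
  refine hdec (dyadicMass f) H _ (fun k n => ‖fourierInv ((E k)ᶜ.indicator f) n‖)
    (dyadicMass_nonneg f) hH (dyadicMass_le_two_mul hf) (fun n => norm_nonneg _) hsup ?_ ?_
  · intro k n
    have hfc : Integrable f circleVol := hf.restrict
    have h1 : fourierInv f n =
        fourierInv ((E k).indicator f) n + fourierInv ((E k)ᶜ.indicator f) n := by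
      rw [← fourierInv_add (hfc.indicator (hmE k)) (hfc.indicator (hmE k).compl),
        Set.indicator_self_add_compl]
    rw [h1]
    refine (norm_add_le _ _).trans ?_
    gcongr
    refine (norm_fourierInv_le _ n).trans (integral_norm_circleVol_le
      (hf.1.indicator (hmE k)) (dyadicMass_nonneg f k) ?_)
    rw [ofReal_dyadicMass hf]
    exact lintegral_indicator_le_topMass hf.1 (hmE k)
      (distr_two_pow_mul_dyadicMass_le hf (hpos k))
  · intro k T
    exact (sum_norm_fourierInv_sq_le (hf2.indicator (hmE k).compl) T).trans
      (integral_sq_below_level_le hfm hf hpos k)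

/-! ### Masses bounded by the coefficients of the rearrangement. -/

theorem memLp_toReal_symmDecrRearr_circleVol (hf2 : MemLp f 2 volume) :
    MemLp (fun x => (symmDecrRearr f x).toReal) 2 circleVol := by
  have hm := (measurable_symmDecrRearr f).ennreal_toReal
  refine MemLp.restrict _ ((memLp_two_iff_integrable_sq hm.aestronglyMeasurable).2
    ⟨(hm.pow_const 2).aestronglyMeasurable, ?_⟩)
  have h1 := (memLp_two_iff_integrable_sq_norm hf2.1).1 hf2
  rw [hasFiniteIntegral_iff_ofReal (Filter.Eventually.of_forall fun x => sq_nonneg _)]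
  refine (lintegral_symmDecrRearr_sq_le hf2.1).trans_lt ?_
  exact (hasFiniteIntegral_iff_ofReal (Filter.Eventually.of_forall fun x => sq_nonneg _)).1 h1.2

theorem dyadicMass_le (hf : Integrable f) (hf2 : MemLp f 2 volume) (k : ℕ) :
    dyadicMass f k ≤ 4 * Real.sqrt (2 * Real.pi) * ((2 ^ k)⁻¹ *
      ∑ n ∈ Finset.Ioo (-2 ^ k : ℤ) (2 ^ k),
        ‖fourierInv (fun x => ((symmDecrRearr f x).toReal : ℂ)) n‖) := by
  have h := setIntegral_ball_le (g := fun x => (symmDecrRearr f x).toReal)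
    (fun x => ENNReal.toReal_nonneg)
    ((memLp_toReal_symmDecrRearr_circleVol hf2).integrable (by norm_num))
    (N := 2 ^ k) (by positivity)
  have hball : Metric.ball (0 : ℝ) (2 ^ k)⁻¹ = Metric.eball 0 (2 ^ k)⁻¹ := by
    rw [← Metric.eball_ofReal, ENNReal.ofReal_inv_of_pos (by positivity),
      ENNReal.ofReal_pow (by norm_num), ENNReal.ofReal_ofNat]
  push_cast at h
  rw [hball, integral_toReal (measurable_symmDecrRearr f).aemeasurable,
    setLIntegral_symmDecrRearr] at h
  · exact h
  -- The rearrangement may be infinite at the origin; finite mass on the ball makes this negligible.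
  · refine ae_lt_top (measurable_symmDecrRearr f) ?_
    rw [setLIntegral_symmDecrRearr]
    exact topMass_ne_top hf _

end

end FourierRearrangement

end

/-! ### The rearrangement inequality. -/

open FourierRearrangement in
theorem corollary3p10 (p : ℝ) (hp : 2 < p) :
    ∃ c : ℝ, ∀ u : FourierRearrangement.SqSummable,
      Summable (fun n : ℤ => ‖u n‖ ^ p) ∧
      Summable (fun n : ℤ => ‖FourierRearrangement.fourierRearr u n‖ ^ p) ∧
      ∑' n : ℤ, ‖u n‖ ^ p ≤ c * ∑' n : ℤ, ‖FourierRearrangement.fourierRearr u n‖ ^ p := by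
  obtain ⟨C, hC, hupper⟩ := exists_tsum_norm_fourierInv_rpow_le hp
  obtain ⟨D, hD, hhardy⟩ := exists_sum_dyadic_average_rpow_le (p := p) (by linarith)
  set G : ℝ := 4 * Real.sqrt (2 * Real.pi) with hG
  refine ⟨C * (G ^ p * D), fun u => ?_⟩
  set I := Set.Ioo (-Real.pi) Real.pi with hI
  set φ := fourierTransform u with hφ
  set f : ℝ → ℂ := I.indicator φ with hf
  have hfm : StronglyMeasurable f := (Lp.stronglyMeasurable φ).indicator measurableSet_Ioo
  have hf2 : MemLp f 2 volume := (memLp_indicator_iff_restrict measurableSet_Ioo).2 (Lp.memLp φ)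
  have hfi : Integrable f := (integrable_indicator_iff measurableSet_Ioo).2
    ((Lp.memLp φ).integrable (by norm_num))
  have hfc : MemLp f 2 circleVol := hf2.restrict _
  have hu : ∀ n, u n = fourierInv f n := fun n => by
    rw [← inner_expLp_fourierTransform u n, inner_expLp]
    exact fourierInv_congr (indicator_ae_eq_restrict measurableSet_Ioo).symm n
  set a : ℤ → ℝ := fun n => ‖fourierRearr u n‖ with ha
  have hs : Summable fun n => a n ^ p :=
    summable_rpow_of_summable_sq (fun n => norm_nonneg _)
      (summable_norm_fourierInv_sq (memLp_toReal_symmDecrRearr_circleVol hf2).ofReal) hp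
  have hsu : Summable fun n => ‖u n‖ ^ p := by
    simp_rw [hu]
    exact summable_rpow_of_summable_sq (fun n => norm_nonneg _) (summable_norm_fourierInv_sq hfc) hp
  refine ⟨hsu, hs, ?_⟩
  simp_rw [hu]
  rw [mul_assoc]
  -- The admissible bound on the dyadic sum is `G ^ p * D * ∑ |u^#(n)| ^ p`: `G` from the Fejér
  -- estimate, `D` from Hardy.
  refine hupper f _ hfm hfi hfc (fun x hx => Set.indicator_of_notMem hx _) fun K => ?_
  rw [mul_assoc]
  refine le_trans ?_ (mul_le_mul_of_nonneg_left (hhardy a (fun n => norm_nonneg _) hs K)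
    (by positivity))
  rw [Finset.mul_sum]
  refine Finset.sum_le_sum fun k _ => ?_
  have hS : 0 ≤ (2 ^ k : ℝ)⁻¹ * ∑ n ∈ Finset.Ioo (-2 ^ k : ℤ) (2 ^ k), a n :=
    mul_nonneg (by positivity) (Finset.sum_nonneg fun n _ => norm_nonneg _)
  rw [mul_left_comm, ← Real.mul_rpow (by positivity) hS]
  gcongr
  · exact dyadicMass_nonneg f k
  · exact dyadicMass_le hfi hf2 k
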